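/- Let $n, d \ge 1$ and let $(A_{jk})_{j,k=1}^n$ be an array of deterministic Hermitian $d \times d$ complex matrices that satisfy $$\sum_{j,k=1}^n A_{jk} = 0 \quad\text{and}\quad \|A_{jk}\| \le R \quad\text{for all } j,k,$$ where $\|\cdot\|$ is the spectral norm. Let $\pi$ be a uniformly random permutation of $\{1,\dots,n\}$, and define the random matrix $X = \sum_{j=1}^n A_{j\pi(j)}$ and the number $\sigma \ge 0$ by $\sigma^2 = \frac1n \big\| \sum_{j,k=1}^n A_{jk}^2 \big\|$. Write $\lambda_{\max}$ for the largest eigenvalue of a Hermitian matrix. Then, for all $t \ge 0$, $$\mathbb{P}\{\lambda_{\max}(X) \ge t\} \le d \cdot \exp\left\{ \frac{-t^2}{12\sigma^2 + 4\sqrt2\, R t} \right\}$$ (the quotient being read as $0$ when its denominator is $0$). Furthermore, $\lambda_{\max}(X)$ is integrable and $$\mathbb{E}\, \lambda_{\max}(X) \le \sigma \sqrt{12 \log d} + 2\sqrt2\, R \log d .$$ -/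

import Mathlib

open MeasureTheory
open scoped ENNReal Nat Matrix.Norms.L2Operator

-- The norm `‖·‖` on complex matrices is the spectral norm: the operator norm on `ℂ^d` with its
-- Euclidean norm.

/-- The largest eigenvalue of a Hermitian matrix `M`. The set `spectrum ℝ M` consists of the real
numbers `x` for which `x • 1 - M` is not invertible, that is, of the real eigenvalues of `M`;
for Hermitian `M` these are all its eigenvalues. -/
noncomputable def lambdaMax {d : ℕ} (M : Matrix (Fin d) (Fin d) ℂ) : ℝ :=
  sSup (spectrum ℝ M)

/-- The largest eigenvalue is indeed an eigenvalue that dominates all the others. -/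
theorem isGreatest_lambdaMax {d : ℕ} (hd : 1 ≤ d) {M : Matrix (Fin d) (Fin d) ℂ}
    (hM : M.IsHermitian) : IsGreatest (Set.range hM.eigenvalues) (lambdaMax M) := by
  have : Nonempty (Fin d) := ⟨⟨0, hd⟩⟩
  rw [lambdaMax, hM.spectrum_real_eq_range_eigenvalues]
  exact ⟨(Set.range_nonempty _).csSup_mem (Set.finite_range _),
    fun x hx => le_csSup (Set.finite_range _).bddAbove hx⟩

/-- `π` is a uniformly random permutation of an `n`-element set on the probability space
`(Ω, μ)`: it is a (measurable) random variable, and it takes each of the `n!` values with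
probability `1 / n!`. -/
def IsUniformRandomPerm {Ω : Type*} [MeasurableSpace Ω] (μ : Measure Ω) {n : ℕ}
    (π : Ω → Equiv.Perm (Fin n)) : Prop :=
  ∀ τ : Equiv.Perm (Fin n),
    MeasurableSet (π ⁻¹' {τ}) ∧ μ (π ⁻¹' {τ}) = ((n ! : ℕ) : ℝ≥0∞)⁻¹

/-- The combinatorial sum `∑ⱼ A_{j τ(j)}` associated with a permutation `τ`. -/
def combinatorialSum {n d : ℕ} (A : Fin n → Fin n → Matrix (Fin d) (Fin d) ℂ)
    (τ : Equiv.Perm (Fin n)) : Matrix (Fin d) (Fin d) ℂ :=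
  ∑ j, A j (τ j)

/-- The variance parameter `σ² = n⁻¹ ‖∑ⱼₖ A_{jk}²‖`. -/
noncomputable def variance2 {n d : ℕ} (A : Fin n → Fin n → Matrix (Fin d) (Fin d) ℂ) : ℝ :=
  (1 / (n : ℝ)) * ‖∑ j, ∑ k, A j k ^ 2‖

/-! The proof is the method of exchangeable pairs with the matrix Laplace transform. Write `m(θ) =
∑_τ tr exp(θ X_τ)` and `v = σ²`. Composing `τ` with a random transposition gives a pair `(X, X')`,
and averaging `X - X'` over all transpositions returns a multiple of `X` because the array sums to
zero. Symmetrising `m'(θ) = ∑_τ tr(X exp(θX))` over the pair and applying a trace mean value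
inequality bounds `m'` by `θ` times a trace of a conditional variance against `exp(θX)`
(`sum_reTrace_combinatorialSum_mul_exp_le`).

That variance contains `∑ⱼ A_{jτ(j)}²`, which is random. After centring it is again a combinatorial
sum `W`, so the same bound applies to `W`, and `A⁴ ≤ R²A²` makes it self-bounding
(`permTraceMGF_centredSquare_le`). Klein's inequality decouples `W` from `exp(θX)`, giving `m' ≤
θ(8R²θ m' + 6v m)` (`permTraceMGFDeriv_le`). Integration yields `m(θ) ≤ n! d exp(3vθ²/(1 - κθ))`
with `κ = 2√2 R` (`permTraceMGF_le`), and suitable choices of `θ` give the tail and the mean. -/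

/-- The function `f` applied to the Hermitian matrix `M` through its eigenvalues. -/
noncomputable def hermFun {d : ℕ} {M : Matrix (Fin d) (Fin d) ℂ} (hM : M.IsHermitian)
    (f : ℝ → ℝ) : Matrix (Fin d) (Fin d) ℂ :=
  (hM.eigenvectorUnitary : Matrix (Fin d) (Fin d) ℂ) *
    Matrix.diagonal (fun i => ((f (hM.eigenvalues i) : ℝ) : ℂ)) *
    star (hM.eigenvectorUnitary : Matrix (Fin d) (Fin d) ℂ)

/-- The real part of the trace. -/
def reTrace {d : ℕ} (M : Matrix (Fin d) (Fin d) ℂ) : ℝ := M.trace.re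

/-- The squared overlap of the `i`-th eigenvector of `M` with the `j`-th eigenvector of `N`. -/
noncomputable def overlap {d : ℕ} {M N : Matrix (Fin d) (Fin d) ℂ} (hM : M.IsHermitian)
    (hN : N.IsHermitian) (i j : Fin d) : ℝ :=
  Complex.normSq ((star (hM.eigenvectorUnitary : Matrix (Fin d) (Fin d) ℂ) *
    (hN.eigenvectorUnitary : Matrix (Fin d) (Fin d) ℂ)) i j)

/-! ### Trace inequalities for functions of two Hermitian matrices -/

section TraceCalculus

open scoped ComplexOrder

variable {d : ℕ} {M N : Matrix (Fin d) (Fin d) ℂ}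

theorem reTrace_add (M N : Matrix (Fin d) (Fin d) ℂ) :
    reTrace (M + N) = reTrace M + reTrace N := by
  simp [reTrace]

theorem reTrace_sub (M N : Matrix (Fin d) (Fin d) ℂ) :
    reTrace (M - N) = reTrace M - reTrace N := by
  simp [reTrace]

theorem reTrace_smul (c : ℝ) (M : Matrix (Fin d) (Fin d) ℂ) :
    reTrace (c • M) = c * reTrace M := by
  simp [reTrace]

theorem reTrace_sum {ι : Type*} (s : Finset ι) (F : ι → Matrix (Fin d) (Fin d) ℂ) :
    reTrace (∑ i ∈ s, F i) = ∑ i ∈ s, reTrace (F i) := by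
  simp [reTrace, Matrix.trace_sum]

theorem reTrace_mul_comm (M N : Matrix (Fin d) (Fin d) ℂ) :
    reTrace (M * N) = reTrace (N * M) := by
  rw [reTrace, Matrix.trace_mul_comm, reTrace]

theorem hermFun_mul (hM : M.IsHermitian) (f g : ℝ → ℝ) :
    hermFun hM f * hermFun hM g = hermFun hM (fun x => f x * g x) := by
  have hU : star (hM.eigenvectorUnitary : Matrix (Fin d) (Fin d) ℂ) *
      (hM.eigenvectorUnitary : Matrix (Fin d) (Fin d) ℂ) = 1 :=
    Unitary.coe_star_mul_self _
  simp only [hermFun, mul_assoc]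
  rw [← mul_assoc (star _) (Subtype.val _), hU, one_mul, ← mul_assoc (Matrix.diagonal _),
    Matrix.diagonal_mul_diagonal]
  simp

theorem hermFun_id (hM : M.IsHermitian) : hermFun hM (fun x => x) = M := by
  conv_rhs => rw [hM.spectral_theorem]
  rfl

theorem hermFun_one (hM : M.IsHermitian) : hermFun hM (fun _ => 1) = 1 := by
  have hU : (hM.eigenvectorUnitary : Matrix (Fin d) (Fin d) ℂ) *
      star (hM.eigenvectorUnitary : Matrix (Fin d) (Fin d) ℂ) = 1 :=
    Unitary.coe_mul_star_self _
  simp [hermFun, hU]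

theorem overlap_nonneg (hM : M.IsHermitian) (hN : N.IsHermitian) (i j : Fin d) :
    0 ≤ overlap hM hN i j := Complex.normSq_nonneg _

/-- The trace of a product of functions of two Hermitian matrices. -/
theorem reTrace_hermFun_mul_hermFun (hM : M.IsHermitian) (hN : N.IsHermitian) (f g : ℝ → ℝ) :
    reTrace (hermFun hM f * hermFun hN g) =
      ∑ i, ∑ j, overlap hM hN i j * (f (hM.eigenvalues i) * g (hN.eigenvalues j)) := by
  set U := (hM.eigenvectorUnitary : Matrix (Fin d) (Fin d) ℂ) with hU
  set V := (hN.eigenvectorUnitary : Matrix (Fin d) (Fin d) ℂ) with hV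
  set D := Matrix.diagonal (fun i => ((f (hM.eigenvalues i) : ℝ) : ℂ)) with hD
  set E := Matrix.diagonal (fun i => ((g (hN.eigenvalues i) : ℝ) : ℂ)) with hE
  have h1 : reTrace (hermFun hM f * hermFun hN g) =
      reTrace (D * (star U * V) * (E * star (star U * V))) := by
    have : hermFun hM f * hermFun hN g = U * (D * (star U * V) * (E * star V)) := by
      simp only [hermFun, ← hU, ← hV, ← hD, ← hE, mul_assoc]
    rw [this, reTrace_mul_comm, star_mul, star_star]
    simp only [mul_assoc]
  rw [h1, reTrace, Matrix.trace]
  simp only [Matrix.diag_apply, Complex.re_sum]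
  refine Finset.sum_congr rfl fun i _ => ?_
  rw [Matrix.mul_apply, Complex.re_sum]
  refine Finset.sum_congr rfl fun j _ => ?_
  rw [hD, hE, Matrix.diagonal_mul, Matrix.diagonal_mul, overlap, Matrix.star_apply,
    ← hU, ← hV, Complex.normSq_apply]
  simp only [Complex.mul_re, Complex.mul_im, Complex.ofReal_re, Complex.ofReal_im,
    Complex.star_def, Complex.conj_re, Complex.conj_im]
  ring

theorem reTrace_hermFun (hM : M.IsHermitian) (f : ℝ → ℝ) :
    reTrace (hermFun hM f) = ∑ i, f (hM.eigenvalues i) := by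
  have hU : star (hM.eigenvectorUnitary : Matrix (Fin d) (Fin d) ℂ) *
      (hM.eigenvectorUnitary : Matrix (Fin d) (Fin d) ℂ) = 1 :=
    Unitary.coe_star_mul_self _
  rw [hermFun, mul_assoc, reTrace_mul_comm, mul_assoc, hU, mul_one, reTrace,
    Matrix.trace_diagonal]
  simp

/-- The overlaps form a doubly stochastic array. Spreading a single trace over both spectra lets
trace inequalities be checked term by term on pairs of eigenvalues. -/
theorem reTrace_hermFun_left (hM : M.IsHermitian) (hN : N.IsHermitian) (f : ℝ → ℝ) :
    reTrace (hermFun hM f) = ∑ i, ∑ j, overlap hM hN i j * f (hM.eigenvalues i) := by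
  have := reTrace_hermFun_mul_hermFun hM hN f (fun _ => 1)
  rw [hermFun_one, mul_one] at this
  simpa using this

theorem reTrace_hermFun_right (hM : M.IsHermitian) (hN : N.IsHermitian) (g : ℝ → ℝ) :
    reTrace (hermFun hN g) = ∑ i, ∑ j, overlap hM hN i j * g (hN.eigenvalues j) := by
  have := reTrace_hermFun_mul_hermFun hM hN (fun _ => 1) g
  rw [hermFun_one, one_mul] at this
  simpa using this

theorem posSemidef_hermFun (hM : M.IsHermitian) {f : ℝ → ℝ} (hf : ∀ x, 0 ≤ f x) :
    (hermFun hM f).PosSemidef := by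
  refine Matrix.PosSemidef.mul_mul_conjTranspose_same
    (Matrix.posSemidef_diagonal_iff.2 fun i => ?_) _
  exact_mod_cast hf _

/-- The trace of the product of a positive semidefinite matrix with a nonnegative function of a
Hermitian matrix is nonnegative. -/
theorem reTrace_mul_hermFun_nonneg (hM : M.IsHermitian) {f : ℝ → ℝ} (hf : ∀ x, 0 ≤ f x)
    {P : Matrix (Fin d) (Fin d) ℂ} (hP : P.PosSemidef) : 0 ≤ reTrace (P * hermFun hM f) := by
  have h : hermFun hM f = hermFun hM (fun x => √(f x)) * hermFun hM (fun x => √(f x)) := by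
    rw [hermFun_mul]
    simp [Real.mul_self_sqrt (hf _)]
  have hH := (posSemidef_hermFun hM (f := fun x => √(f x)) fun x => Real.sqrt_nonneg _).1
  rw [h, ← mul_assoc, reTrace_mul_comm, ← mul_assoc]
  have := hP.mul_mul_conjTranspose_same (hermFun hM (fun x => √(f x)))
  rw [hH.eq] at this
  exact (Complex.le_def.1 this.trace_nonneg).1

theorem reTrace_mul_hermFun_mono (hM : M.IsHermitian) {f : ℝ → ℝ} (hf : ∀ x, 0 ≤ f x)
    {P Q : Matrix (Fin d) (Fin d) ℂ} (hPQ : (Q - P).PosSemidef) :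
    reTrace (P * hermFun hM f) ≤ reTrace (Q * hermFun hM f) := by
  have := reTrace_mul_hermFun_nonneg hM hf hPQ
  rw [sub_mul, reTrace_sub] at this
  linarith

/-- The derivative of the exponential is convex, so its mean over an interval is at most the mean of
its endpoint values. With `u = θ(x - y)` this is `(2 - u)eᵘ ≤ 2 + u`. -/
theorem exp_secant_le_trapezoid {x y θ : ℝ} (hθ : 0 ≤ θ) :
    (x - y) * (Real.exp (θ * x) - Real.exp (θ * y)) ≤
      θ / 2 * ((x - y) ^ 2 * (Real.exp (θ * x) + Real.exp (θ * y))) := by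
  wlog hxy : y ≤ x generalizing x y
  · have := this (x := y) (y := x) (le_of_not_ge hxy)
    linarith
  have key : ∀ u : ℝ, 0 ≤ u → 0 ≤ 2 + u - (2 - u) * Real.exp u := by
    intro u hu
    have hd : ∀ v : ℝ, HasDerivAt (fun v : ℝ => 2 + v - (2 - v) * Real.exp v)
        (1 - ((-1) * Real.exp v + (2 - v) * Real.exp v)) v := fun v =>
      ((hasDerivAt_id v).const_add 2).sub
        (((hasDerivAt_id v).const_sub 2).mul (Real.hasDerivAt_exp v))
    have hmono : Monotone (fun v : ℝ => 2 + v - (2 - v) * Real.exp v) := by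
      refine monotone_of_hasDerivAt_nonneg hd fun v => ?_
      have h1 := Real.add_one_le_exp (-v)
      have h2 := mul_le_mul_of_nonneg_right h1 (Real.exp_pos v).le
      rw [← Real.exp_add, neg_add_cancel, Real.exp_zero] at h2
      simp only [Pi.zero_apply]
      linarith
    have := hmono hu
    simpa using this
  have h1 := key (θ * (x - y)) (mul_nonneg hθ (sub_nonneg.2 hxy))
  have h2 : Real.exp (θ * x) = Real.exp (θ * y) * Real.exp (θ * (x - y)) := by
    rw [← Real.exp_add]; ring_nf
  have h3 := mul_nonneg (mul_nonneg (sub_nonneg.2 hxy) (Real.exp_pos (θ * y)).le) h1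
  rw [h2]
  linarith

/-- The mean value trace inequality for the exponential function. -/
theorem mean_value_trace_exp (hM : M.IsHermitian) (hN : N.IsHermitian) {θ : ℝ} (hθ : 0 ≤ θ) :
    reTrace ((M - N) * (hermFun hM (fun x => Real.exp (θ * x)) -
        hermFun hN (fun x => Real.exp (θ * x)))) ≤
      θ / 2 * reTrace ((M - N) ^ 2 * (hermFun hM (fun x => Real.exp (θ * x)) +
        hermFun hN (fun x => Real.exp (θ * x)))) := by
  set e : ℝ → ℝ := fun x => Real.exp (θ * x) with he
  have hMf : ∀ f, M * hermFun hM f = hermFun hM (fun x => x * f x) := fun f => by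
    have := hermFun_mul hM (fun x => x) f
    rwa [hermFun_id hM] at this
  have hfM : ∀ f, hermFun hM f * M = hermFun hM (fun x => f x * x) := fun f => by
    have := hermFun_mul hM f (fun x => x)
    rwa [hermFun_id hM] at this
  have hNf : ∀ f, N * hermFun hN f = hermFun hN (fun x => x * f x) := fun f => by
    have := hermFun_mul hN (fun x => x) f
    rwa [hermFun_id hN] at this
  have hfN : ∀ f, hermFun hN f * N = hermFun hN (fun x => f x * x) := fun f => by
    have := hermFun_mul hN f (fun x => x)
    rwa [hermFun_id hN] at this
  have hMg : ∀ g, reTrace (M * hermFun hN g) =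
      ∑ i, ∑ j, overlap hM hN i j * (hM.eigenvalues i * g (hN.eigenvalues j)) := fun g => by
    have := reTrace_hermFun_mul_hermFun hM hN (fun x => x) g
    rwa [hermFun_id hM] at this
  have hfN' : ∀ f, reTrace (hermFun hM f * N) =
      ∑ i, ∑ j, overlap hM hN i j * (f (hM.eigenvalues i) * hN.eigenvalues j) := fun f => by
    have := reTrace_hermFun_mul_hermFun hM hN f (fun x => x)
    rwa [hermFun_id hN] at this
  have hM2 : M * M = hermFun hM (fun x => x * x) := by
    have := hMf (fun x => x)
    rwa [hermFun_id hM] at this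
  have hN2 : N * N = hermFun hN (fun x => x * x) := by
    have := hNf (fun x => x)
    rwa [hermFun_id hN] at this
  -- In the two eigenbases both sides become sums with the same nonnegative weights, which leaves a
  -- scalar inequality.
  have hl : reTrace ((M - N) * (hermFun hM e - hermFun hN e)) =
      ∑ i, ∑ j, overlap hM hN i j * ((hM.eigenvalues i - hN.eigenvalues j) *
        (e (hM.eigenvalues i) - e (hN.eigenvalues j))) := by
    have : (M - N) * (hermFun hM e - hermFun hN e) =
        M * hermFun hM e - M * hermFun hN e - N * hermFun hM e + N * hermFun hN e := by
      noncomm_ring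
    rw [this, reTrace_add, reTrace_sub, reTrace_sub, reTrace_mul_comm N, hMf, hNf, hfN', hMg,
      reTrace_hermFun_left hM hN, reTrace_hermFun_right hM hN]
    simp only [← Finset.sum_sub_distrib, ← Finset.sum_add_distrib]
    refine Finset.sum_congr rfl fun i _ => Finset.sum_congr rfl fun j _ => ?_
    ring
  have hr : reTrace ((M - N) ^ 2 * (hermFun hM e + hermFun hN e)) =
      ∑ i, ∑ j, overlap hM hN i j * ((hM.eigenvalues i - hN.eigenvalues j) ^ 2 *
        (e (hM.eigenvalues i) + e (hN.eigenvalues j))) := by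
    have h1 : (M - N) ^ 2 * (hermFun hM e + hermFun hN e) =
        M * (M * hermFun hM e) - M * (N * hermFun hM e) - N * (M * hermFun hM e)
          + N * N * hermFun hM e
        + M * M * hermFun hN e - M * (N * hermFun hN e) - N * (M * hermFun hN e)
          + N * (N * hermFun hN e) := by
      noncomm_ring
    have h2 : reTrace (M * (N * hermFun hM e)) = reTrace (hermFun hM (fun x => e x * x) * N) := by
      rw [reTrace_mul_comm, mul_assoc, hfM, reTrace_mul_comm]
    have h3 : reTrace (N * (M * hermFun hM e)) = reTrace (hermFun hM (fun x => x * e x) * N) := by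
      rw [hMf, reTrace_mul_comm]
    have h4 : reTrace (N * (M * hermFun hN e)) = reTrace (M * hermFun hN (fun x => e x * x)) := by
      rw [reTrace_mul_comm, mul_assoc, hfN]
    have h5 : reTrace (N * N * hermFun hM e) =
        reTrace (hermFun hM e * hermFun hN (fun x => x * x)) := by
      rw [hN2, reTrace_mul_comm]
    rw [h1]
    simp only [reTrace_add, reTrace_sub]
    rw [h2, h3, h4, h5, hM2, hMf, hMf, hNf, hNf, hfN', hfN', hMg, hMg,
      reTrace_hermFun_mul_hermFun, reTrace_hermFun_mul_hermFun, reTrace_hermFun_left hM hN,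
      reTrace_hermFun_right hM hN]
    simp only [← Finset.sum_sub_distrib, ← Finset.sum_add_distrib]
    refine Finset.sum_congr rfl fun i _ => Finset.sum_congr rfl fun j _ => ?_
    ring
  rw [hl, hr, Finset.mul_sum]
  refine Finset.sum_le_sum fun i _ => ?_
  rw [Finset.mul_sum]
  refine Finset.sum_le_sum fun j _ => ?_
  rw [mul_left_comm (θ / 2)]
  exact mul_le_mul_of_nonneg_left (exp_secant_le_trapezoid hθ) (overlap_nonneg hM hN i j)

/-- Klein's inequality for the exponential function. -/
theorem klein_trace_exp (hM : M.IsHermitian) (hN : N.IsHermitian) (θ a b : ℝ) :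
    a * reTrace (N * hermFun hM (fun x => Real.exp (θ * x)))
        - θ * reTrace (M * hermFun hM (fun x => Real.exp (θ * x)))
        + (b + 1) * ∑ i, Real.exp (θ * hM.eigenvalues i) ≤
      ∑ i, Real.exp (a * hN.eigenvalues i + b) := by
  have hMf : M * hermFun hM (fun x => Real.exp (θ * x)) =
      hermFun hM (fun x => x * Real.exp (θ * x)) := by
    have := hermFun_mul hM (fun x => x) (fun x => Real.exp (θ * x))
    rwa [hermFun_id hM] at this
  have hNf : reTrace (hermFun hM (fun x => Real.exp (θ * x)) * N) = ∑ i, ∑ j, overlap hM hN i j *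
      (Real.exp (θ * hM.eigenvalues i) * hN.eigenvalues j) := by
    have := reTrace_hermFun_mul_hermFun hM hN (fun x => Real.exp (θ * x)) (fun x => x)
    rwa [hermFun_id hN] at this
  have h1 := reTrace_hermFun hM (fun x => Real.exp (θ * x))
  have h2 := reTrace_hermFun hN (fun x => Real.exp (a * x + b))
  rw [← h1, ← h2, reTrace_mul_comm N, hNf, hMf, reTrace_hermFun_left hM hN,
    reTrace_hermFun_left hM hN, reTrace_hermFun_right hM hN]
  simp only [Finset.mul_sum, ← Finset.sum_sub_distrib, ← Finset.sum_add_distrib]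
  refine Finset.sum_le_sum fun i _ => Finset.sum_le_sum fun j _ => ?_
  set x := hM.eigenvalues i
  set y := hN.eigenvalues j
  -- The scalar inequality is that the exponential lies above its tangent at `θx`.
  have h3 := Real.add_one_le_exp (a * y + b - θ * x)
  have h4 : Real.exp (a * y + b) = Real.exp (θ * x) * Real.exp (a * y + b - θ * x) := by
    rw [← Real.exp_add]; ring_nf
  have h5 := mul_le_mul_of_nonneg_left h3 (Real.exp_pos (θ * x)).le
  have h6 := mul_le_mul_of_nonneg_left h5 (overlap_nonneg hM hN i j)
  rw [h4]
  linarith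

end TraceCalculus

/-! ### The exchangeable pair of a random transposition -/

section ExchangeablePair

open scoped ComplexOrder

variable {n d : ℕ}

theorem isHermitian_combinatorialSum {A : Fin n → Fin n → Matrix (Fin d) (Fin d) ℂ}
    (hA : ∀ j k, (A j k).IsHermitian) (τ : Equiv.Perm (Fin n)) :
    (combinatorialSum A τ).IsHermitian := by
  rw [combinatorialSum, Matrix.IsHermitian, Matrix.conjTranspose_sum]
  exact Finset.sum_congr rfl fun j _ => (hA j _).eq

theorem combinatorialSum_mul_swap (A : Fin n → Fin n → Matrix (Fin d) (Fin d) ℂ)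
    (τ : Equiv.Perm (Fin n)) (j k : Fin n) :
    combinatorialSum A τ - combinatorialSum A (τ * Equiv.swap j k) =
      A j (τ j) + A k (τ k) - A j (τ k) - A k (τ j) := by
  rw [combinatorialSum, combinatorialSum, ← Finset.sum_sub_distrib]
  by_cases hjk : j = k
  · subst hjk
    simp
  · rw [Finset.sum_eq_add j k hjk (fun c _ hc => ?_) (by simp) (by simp)]
    · simp only [Equiv.Perm.mul_apply, Equiv.swap_apply_left, Equiv.swap_apply_right]
      abel
    · rw [Equiv.Perm.mul_apply, Equiv.swap_apply_of_ne_of_ne hc.1 hc.2, sub_self]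

theorem posSemidef_sq {M : Matrix (Fin d) (Fin d) ℂ} (hM : M.IsHermitian) :
    (M ^ 2).PosSemidef := by
  have := Matrix.posSemidef_conjTranspose_mul_self M
  rwa [hM.eq, ← pow_two] at this

/-- Convexity of the matrix square, for four summands. -/
theorem posSemidef_four_mul_sum_sq_sub_sq {a b c e : Matrix (Fin d) (Fin d) ℂ}
    (ha : a.IsHermitian) (hb : b.IsHermitian) (hc : c.IsHermitian) (he : e.IsHermitian) :
    ((4 : ℝ) • (a ^ 2 + b ^ 2 + c ^ 2 + e ^ 2) - (a + b - c - e) ^ 2).PosSemidef := by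
  -- The gap is the sum of the squared differences of all six pairs among `a, b, -c, -e`.
  have h : (4 : ℝ) • (a ^ 2 + b ^ 2 + c ^ 2 + e ^ 2) - (a + b - c - e) ^ 2 =
      (a - b) ^ 2 + (a + c) ^ 2 + (a + e) ^ 2 + (b + c) ^ 2 + (b + e) ^ 2 + (c - e) ^ 2 := by
    have h4 : ∀ M : Matrix (Fin d) (Fin d) ℂ, (4 : ℝ) • M = M + M + M + M := fun M => by
      module
    rw [h4]
    noncomm_ring
  rw [h]
  exact (((((posSemidef_sq (ha.sub hb)).add (posSemidef_sq (ha.add hc))).add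
    (posSemidef_sq (ha.add he))).add (posSemidef_sq (hb.add hc))).add
    (posSemidef_sq (hb.add he))).add (posSemidef_sq (hc.sub he))

/-- The derivative bound for the trace moment generating function of a combinatorial sum, from
the exchangeable pair that composes the permutation with a random transposition. The array `B`
may differ from `A` by a constant matrix. -/
theorem sum_reTrace_combinatorialSum_mul_exp_le {A B : Fin n → Fin n → Matrix (Fin d) (Fin d) ℂ}
    (hn : 1 ≤ n) (hA : ∀ j k, (A j k).IsHermitian) (hB : ∀ j k, (B j k).IsHermitian)
    (hsum : ∑ j, ∑ k, A j k = 0) {C : Matrix (Fin d) (Fin d) ℂ} (hAB : ∀ j k, A j k = B j k + C)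
    {θ : ℝ} (hθ : 0 ≤ θ) :
    ∑ τ, reTrace (combinatorialSum A τ *
        hermFun (isHermitian_combinatorialSum hA τ) (fun x => Real.exp (θ * x))) ≤
      θ * ∑ τ, reTrace (((2 : ℝ) • ∑ j, B j (τ j) ^ 2 + (2 / (n : ℝ)) • ∑ j, ∑ k, B j k ^ 2) *
        hermFun (isHermitian_combinatorialSum hA τ) (fun x => Real.exp (θ * x))) := by
  have hn0 : (0 : ℝ) < n := by exact_mod_cast hn
  set X := combinatorialSum A with hX
  set E : Equiv.Perm (Fin n) → Matrix (Fin d) (Fin d) ℂ := fun τ =>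
    hermFun (isHermitian_combinatorialSum hA τ) (fun x => Real.exp (θ * x)) with hE
  have hcol : ∀ (F : Fin n → Fin n → Matrix (Fin d) (Fin d) ℂ) (τ : Equiv.Perm (Fin n)),
      ∑ j, ∑ k, F j (τ k) = ∑ j, ∑ k, F j k := fun F τ =>
    Finset.sum_congr rfl fun j _ => Equiv.sum_comp τ (F j)
  have hcol' : ∀ (F : Fin n → Fin n → Matrix (Fin d) (Fin d) ℂ) (τ : Equiv.Perm (Fin n)),
      ∑ j, ∑ k, F k (τ j) = ∑ j, ∑ k, F j k := fun F τ => by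
    rw [Finset.sum_comm]; exact hcol F τ
  have hdiff : ∀ τ, ∑ j, ∑ k, (X τ - X (τ * Equiv.swap j k)) = (2 * n : ℝ) • X τ := by
    intro τ
    simp only [hX, combinatorialSum_mul_swap]
    simp only [Finset.sum_sub_distrib, Finset.sum_add_distrib,
      hcol A τ, hcol' A τ, hsum, sub_zero, Finset.sum_const, Finset.card_univ, Fintype.card_fin,
      ← Finset.smul_sum, ← Nat.cast_smul_eq_nsmul ℝ, combinatorialSum]
    module
  have hsq : ∀ τ : Equiv.Perm (Fin n),
      ∑ j, ∑ k, (B j (τ j) ^ 2 + B k (τ k) ^ 2 + B j (τ k) ^ 2 + B k (τ j) ^ 2) =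
      (n : ℝ) • ((2 : ℝ) • ∑ j, B j (τ j) ^ 2 + (2 / (n : ℝ)) • ∑ j, ∑ k, B j k ^ 2) := by
    intro τ
    simp only [Finset.sum_add_distrib, hcol (fun j k => B j k ^ 2) τ,
      hcol' (fun j k => B j k ^ 2) τ, Finset.sum_const, Finset.card_univ, Fintype.card_fin,
      ← Finset.smul_sum, ← Nat.cast_smul_eq_nsmul ℝ]
    rw [smul_add, smul_smul (n : ℝ) (2 / (n : ℝ)), mul_div_cancel₀ _ hn0.ne']
    module
  have hpair : ∀ j k, ∑ τ, reTrace ((X τ - X (τ * Equiv.swap j k)) * E τ) ≤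
      θ * 2 * ∑ τ, reTrace ((B j (τ j) ^ 2 + B k (τ k) ^ 2 + B j (τ k) ^ 2 + B k (τ j) ^ 2) *
        E τ) := by
    intro j k
    have hinv : ∀ G : Equiv.Perm (Fin n) → ℝ, ∑ τ, G (τ * Equiv.swap j k) = ∑ τ, G τ := fun G =>
      Equiv.sum_comp (Equiv.mulRight (Equiv.swap j k)) G
    have hss : ∀ τ : Equiv.Perm (Fin n), τ * Equiv.swap j k * Equiv.swap j k = τ := fun τ => by
      rw [mul_assoc, Equiv.swap_mul_self, mul_one]
    have e1 := hinv fun τ => reTrace ((X τ - X (τ * Equiv.swap j k)) * E τ)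
    have e2 := hinv fun τ => reTrace ((X τ - X (τ * Equiv.swap j k)) ^ 2 * E τ)
    simp only [hss] at e1 e2
    -- Replacing `τ` by `τ * swap j k` exchanges `X` and `X'`; the difference is odd under this and
    -- its square is even.
    have h1 : ∑ τ, reTrace ((X τ - X (τ * Equiv.swap j k)) * (E τ - E (τ * Equiv.swap j k))) =
        2 * ∑ τ, reTrace ((X τ - X (τ * Equiv.swap j k)) * E τ) := by
      rw [two_mul]
      nth_rewrite 2 [← e1]
      rw [← Finset.sum_add_distrib]
      refine Finset.sum_congr rfl fun τ _ => ?_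
      rw [← reTrace_add]
      congr 1
      noncomm_ring
    have h2 : ∑ τ, reTrace ((X τ - X (τ * Equiv.swap j k)) ^ 2 *
        (E τ + E (τ * Equiv.swap j k))) =
        2 * ∑ τ, reTrace ((X τ - X (τ * Equiv.swap j k)) ^ 2 * E τ) := by
      rw [two_mul]
      nth_rewrite 2 [← e2]
      rw [← Finset.sum_add_distrib]
      refine Finset.sum_congr rfl fun τ _ => ?_
      rw [← reTrace_add, mul_add]
      congr 2
      rw [← neg_sub (X τ), neg_sq]
    have h3 : ∑ τ, reTrace ((X τ - X (τ * Equiv.swap j k)) * (E τ - E (τ * Equiv.swap j k))) ≤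
        θ / 2 * ∑ τ, reTrace ((X τ - X (τ * Equiv.swap j k)) ^ 2 *
          (E τ + E (τ * Equiv.swap j k))) := by
      rw [Finset.mul_sum]
      exact Finset.sum_le_sum fun τ _ => mean_value_trace_exp _ _ hθ
    have h4 : ∑ τ, reTrace ((X τ - X (τ * Equiv.swap j k)) ^ 2 * E τ) ≤
        4 * ∑ τ, reTrace ((B j (τ j) ^ 2 + B k (τ k) ^ 2 + B j (τ k) ^ 2 + B k (τ j) ^ 2) *
          E τ) := by
      rw [Finset.mul_sum]
      refine Finset.sum_le_sum fun τ _ => ?_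
      rw [← reTrace_smul, ← smul_mul_assoc]
      refine reTrace_mul_hermFun_mono _ (fun x => (Real.exp_pos _).le) ?_
      -- The constant `C` enters twice with each sign and cancels, so uncentred entries may be used.
      have : X τ - X (τ * Equiv.swap j k) = B j (τ j) + B k (τ k) - B j (τ k) - B k (τ j) := by
        rw [hX, combinatorialSum_mul_swap]
        simp only [hAB]
        abel
      rw [this]
      exact posSemidef_four_mul_sum_sq_sub_sq (hB _ _) (hB _ _) (hB _ _) (hB _ _)
    rw [h1, h2] at h3
    have h5 := mul_le_mul_of_nonneg_left h4 hθ
    linarith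
  have htotal : ∀ F : Fin n → Fin n → Equiv.Perm (Fin n) → Matrix (Fin d) (Fin d) ℂ,
      ∑ j, ∑ k, ∑ τ, reTrace (F j k τ * E τ) =
        ∑ τ, reTrace ((∑ j, ∑ k, F j k τ) * E τ) := by
    intro F
    simp only [Finset.sum_mul, reTrace_sum]
    rw [Finset.sum_comm (s := (Finset.univ : Finset (Equiv.Perm (Fin n))))]
    exact Finset.sum_congr rfl fun j _ => Finset.sum_comm
  have h := Finset.sum_le_sum fun j (_ : j ∈ Finset.univ) =>
    Finset.sum_le_sum fun k (_ : k ∈ Finset.univ) => hpair j k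
  simp only [← Finset.mul_sum] at h
  rw [htotal (fun j k τ => X τ - X (τ * Equiv.swap j k)), htotal (fun j k τ =>
    B j (τ j) ^ 2 + B k (τ k) ^ 2 + B j (τ k) ^ 2 + B k (τ j) ^ 2)] at h
  simp only [hdiff, hsq, smul_mul_assoc, reTrace_smul, ← Finset.mul_sum] at h
  refine le_of_mul_le_mul_left ?_ (mul_pos two_pos hn0)
  linarith

/-- Averaging over cyclic shifts of the values of `τ` already turns each term into a full row sum.
-/
theorem sum_combinatorialSum_eq_zero {A : Fin n → Fin n → Matrix (Fin d) (Fin d) ℂ}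
    (hn : 1 ≤ n) (hsum : ∑ j, ∑ k, A j k = 0) : ∑ τ, combinatorialSum A τ = 0 := by
  have hn0 : (n : ℝ) ≠ 0 := by exact_mod_cast (Nat.pos_of_ne_zero (by omega)).ne'
  have : NeZero n := ⟨by omega⟩
  have h : ∀ s : Equiv.Perm (Fin n), ∑ τ, combinatorialSum A (s * τ) = ∑ τ, combinatorialSum A τ :=
    fun s => Equiv.sum_comp (Equiv.mulLeft s) _
  have h2 : ∑ i : Fin n, ∑ τ, combinatorialSum A (Equiv.addRight i * τ) = 0 := by
    rw [Finset.sum_comm]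
    refine Finset.sum_eq_zero fun τ _ => ?_
    simp only [combinatorialSum]
    rw [Finset.sum_comm, ← hsum]
    exact Finset.sum_congr rfl fun j _ => Equiv.sum_comp (Equiv.addLeft (τ j)) (A j)
  simp only [h, Finset.sum_const, Finset.card_univ, Fintype.card_fin,
    ← Nat.cast_smul_eq_nsmul ℝ] at h2
  exact (smul_eq_zero.1 h2).resolve_left hn0

end ExchangeablePair

/-! ### Differential inequalities for the trace moment generating function -/

section TraceMGF

open scoped ComplexOrder

variable {n d : ℕ} {A : Fin n → Fin n → Matrix (Fin d) (Fin d) ℂ}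

/-- The unnormalized trace moment generating function `∑_τ tr exp(θ X_τ)` of the combinatorial
sum of an array. -/
noncomputable def permTraceMGF (hA : ∀ j k, (A j k).IsHermitian) (θ : ℝ) : ℝ :=
  ∑ τ, ∑ i, Real.exp (θ * (isHermitian_combinatorialSum hA τ).eigenvalues i)

/-- The derivative of the trace moment generating function. -/
noncomputable def permTraceMGFDeriv (hA : ∀ j k, (A j k).IsHermitian) (θ : ℝ) : ℝ :=
  ∑ τ, reTrace (combinatorialSum A τ *
    hermFun (isHermitian_combinatorialSum hA τ) (fun x => Real.exp (θ * x)))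

theorem hasDerivAt_permTraceMGF (hA : ∀ j k, (A j k).IsHermitian) (θ : ℝ) :
    HasDerivAt (permTraceMGF hA) (permTraceMGFDeriv hA θ) θ := by
  have h : permTraceMGFDeriv hA θ = ∑ τ, ∑ i,
      Real.exp (θ * (isHermitian_combinatorialSum hA τ).eigenvalues i) *
        (1 * (isHermitian_combinatorialSum hA τ).eigenvalues i) := by
    refine Finset.sum_congr rfl fun τ _ => ?_
    have := hermFun_mul (isHermitian_combinatorialSum hA τ) (fun x => x)
      (fun x => Real.exp (θ * x))
    rw [hermFun_id] at this
    rw [this, reTrace_hermFun]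
    exact Finset.sum_congr rfl fun i _ => by ring
  rw [h]
  exact HasDerivAt.fun_sum fun τ _ => HasDerivAt.fun_sum fun i _ =>
    ((hasDerivAt_id θ).mul_const _).exp

theorem permTraceMGF_nonneg (hA : ∀ j k, (A j k).IsHermitian) (θ : ℝ) :
    0 ≤ permTraceMGF hA θ :=
  Finset.sum_nonneg fun _ _ => Finset.sum_nonneg fun _ _ => (Real.exp_pos _).le

theorem permTraceMGF_zero (hA : ∀ j k, (A j k).IsHermitian) :
    permTraceMGF hA 0 = n ! * d := by
  simp [permTraceMGF, Fintype.card_perm]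

/-- Jensen's inequality: the sum has mean zero and `1 + x ≤ eˣ`. -/
theorem permTraceMGF_ge (hn : 1 ≤ n) (hA : ∀ j k, (A j k).IsHermitian)
    (hsum : ∑ j, ∑ k, A j k = 0) (θ : ℝ) : (n ! * d : ℝ) ≤ permTraceMGF hA θ := by
  have h : ∑ τ, ∑ i, (1 + θ * (isHermitian_combinatorialSum hA τ).eigenvalues i) = n ! * d := by
    have h1 : ∀ τ, ∑ i, (isHermitian_combinatorialSum hA τ).eigenvalues i =
        reTrace (combinatorialSum A τ) := fun τ => by
      have := reTrace_hermFun (isHermitian_combinatorialSum hA τ) (fun x => x)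
      rw [← this, hermFun_id]
    simp only [Finset.sum_add_distrib, ← Finset.mul_sum, h1]
    rw [← reTrace_sum, sum_combinatorialSum_eq_zero hn hsum]
    simp [reTrace, Fintype.card_perm]
  rw [← h]
  refine Finset.sum_le_sum fun τ _ => Finset.sum_le_sum fun i _ => ?_
  rw [add_comm]
  exact Real.add_one_le_exp _

theorem sum_reTrace_hermFun_exp (hA : ∀ j k, (A j k).IsHermitian) (θ : ℝ) :
    ∑ τ, reTrace (hermFun (isHermitian_combinatorialSum hA τ) (fun x => Real.exp (θ * x))) =
      permTraceMGF hA θ :=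
  Finset.sum_congr rfl fun _ _ => reTrace_hermFun _ _

/-- Grönwall's argument: `f` times the integrating factor `exp(-Ks²/2)` is antitone on `[0, θ]`. -/
theorem le_mul_exp_of_deriv_le {f f' : ℝ → ℝ} (hf : ∀ s, HasDerivAt f (f' s) s) {K θ : ℝ}
    (hθ : 0 ≤ θ) (h : ∀ s, 0 ≤ s → s ≤ θ → f' s ≤ K * s * f s) :
    f θ ≤ f 0 * Real.exp (K * θ ^ 2 / 2) := by
  have hg : ∀ s, HasDerivAt (fun s => f s * Real.exp (-(K * s ^ 2 / 2)))
      ((f' s - K * s * f s) * Real.exp (-(K * s ^ 2 / 2))) s := by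
    intro s
    have h1 : HasDerivAt (fun s : ℝ => -(K * s ^ 2 / 2)) (-(K * s)) s := by
      refine ((((hasDerivAt_id s).pow 2).const_mul K).div_const 2).neg.congr_deriv ?_
      simp only [id, Nat.cast_ofNat]
      ring
    refine ((hf s).mul h1.exp).congr_deriv ?_
    ring
  have hanti : AntitoneOn (fun s => f s * Real.exp (-(K * s ^ 2 / 2))) (Set.Icc 0 θ) := by
    refine antitoneOn_of_deriv_nonpos (convex_Icc 0 θ)
      (fun s _ => (hg s).continuousAt.continuousWithinAt)
      (fun s _ => (hg s).differentiableAt.differentiableWithinAt) fun s hs => ?_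
    rw [interior_Icc] at hs
    rw [(hg s).deriv]
    exact mul_nonpos_of_nonpos_of_nonneg (sub_nonpos.2 (h s hs.1.le hs.2.le)) (Real.exp_pos _).le
  have h2 := hanti (Set.left_mem_Icc.2 hθ) (Set.right_mem_Icc.2 hθ) hθ
  simp only [Real.exp_neg] at h2
  rw [← div_eq_mul_inv, div_le_iff₀ (Real.exp_pos _)] at h2
  simpa using h2

open scoped MatrixOrder in
theorem posSemidef_norm_smul_one_sub {M : Matrix (Fin d) (Fin d) ℂ} (hM : M.IsHermitian) {r : ℝ}
    (hr : ‖M‖ ≤ r) : (r • (1 : Matrix (Fin d) (Fin d) ℂ) - M).PosSemidef := by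
  have h1 : M ≤ algebraMap ℝ (Matrix (Fin d) (Fin d) ℂ) ‖M‖ :=
    IsSelfAdjoint.le_algebraMap_norm_self hM
  have h2 := Matrix.le_iff.1 h1
  rw [Algebra.algebraMap_eq_smul_one] at h2
  have h3 : ((r - ‖M‖) • (1 : Matrix (Fin d) (Fin d) ℂ)).PosSemidef :=
    Matrix.PosSemidef.one.smul (sub_nonneg.2 hr)
  convert h3.add h2 using 1
  module

/-- Conjugate `R² - M² ≥ 0` by `M`. -/
theorem posSemidef_smul_sq_sub_pow_four {M : Matrix (Fin d) (Fin d) ℂ} (hM : M.IsHermitian)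
    {R : ℝ} (hR : ‖M‖ ≤ R) : (R ^ 2 • M ^ 2 - (M ^ 2) ^ 2).PosSemidef := by
  have h1 : ‖M ^ 2‖ ≤ R ^ 2 := (norm_pow_le' M two_pos).trans (pow_le_pow_left₀ (norm_nonneg _) hR 2)
  have h2 := (posSemidef_norm_smul_one_sub (hM.pow 2) h1).mul_mul_conjTranspose_same M
  rw [hM.eq] at h2
  convert h2 using 1
  rw [mul_sub, sub_mul, mul_smul_comm, smul_mul_assoc, mul_one]
  congr 1 <;> noncomm_ring

theorem isHermitian_sum_sum_sq (hA : ∀ j k, (A j k).IsHermitian) :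
    (∑ j, ∑ k, A j k ^ 2).IsHermitian := by
  simp only [Matrix.IsHermitian, Matrix.conjTranspose_sum]
  exact Finset.sum_congr rfl fun j _ => Finset.sum_congr rfl fun k _ => ((hA j k).pow 2).eq

theorem variance2_nonneg (A : Fin n → Fin n → Matrix (Fin d) (Fin d) ℂ) : 0 ≤ variance2 A := by
  unfold variance2; positivity

theorem posSemidef_variance2_smul_one_sub (hA : ∀ j k, (A j k).IsHermitian) :
    (variance2 A • (1 : Matrix (Fin d) (Fin d) ℂ) -
      (1 / (n : ℝ)) • ∑ j, ∑ k, A j k ^ 2).PosSemidef := by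
  have h := (posSemidef_norm_smul_one_sub (isHermitian_sum_sum_sq hA) le_rfl).smul
    (show (0 : ℝ) ≤ 1 / n by positivity)
  rwa [smul_sub, smul_smul] at h

/-- The array of the centred squares of the entries. -/
noncomputable def centredSquare (A : Fin n → Fin n → Matrix (Fin d) (Fin d) ℂ) (j k : Fin n) :
    Matrix (Fin d) (Fin d) ℂ :=
  A j k ^ 2 - (1 / (n : ℝ) ^ 2) • ∑ j, ∑ k, A j k ^ 2

theorem isHermitian_centredSquare (hA : ∀ j k, (A j k).IsHermitian) (j k : Fin n) :
    (centredSquare A j k).IsHermitian := by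
  refine ((hA j k).pow 2).sub ?_
  have h := isHermitian_sum_sum_sq hA
  rw [Matrix.IsHermitian, Matrix.conjTranspose_smul, h.eq, star_trivial]

theorem sum_centredSquare (hn : 1 ≤ n) (A : Fin n → Fin n → Matrix (Fin d) (Fin d) ℂ) :
    ∑ j, ∑ k, centredSquare A j k = 0 := by
  have hn0 : (n : ℝ) ≠ 0 := by exact_mod_cast (Nat.pos_of_ne_zero (by omega)).ne'
  simp only [centredSquare, Finset.sum_sub_distrib, Finset.sum_const, Finset.card_univ,
    Fintype.card_fin, ← Nat.cast_smul_eq_nsmul ℝ, smul_smul]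
  rw [show (n : ℝ) * (n * (1 / (n : ℝ) ^ 2)) = 1 by field_simp, one_smul, sub_self]

theorem combinatorialSum_centredSquare (hn : 1 ≤ n)
    (A : Fin n → Fin n → Matrix (Fin d) (Fin d) ℂ) (τ : Equiv.Perm (Fin n)) :
    combinatorialSum (centredSquare A) τ =
      ∑ j, A j (τ j) ^ 2 - (1 / (n : ℝ)) • ∑ j, ∑ k, A j k ^ 2 := by
  have hn0 : (n : ℝ) ≠ 0 := by exact_mod_cast (Nat.pos_of_ne_zero (by omega)).ne'
  simp only [combinatorialSum, centredSquare, Finset.sum_sub_distrib, Finset.sum_const,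
    Finset.card_univ, Fintype.card_fin, ← Nat.cast_smul_eq_nsmul ℝ, smul_smul]
  rw [show (n : ℝ) * (1 / (n : ℝ) ^ 2) = 1 / n by field_simp]

/-- Since `A⁴ ≤ R²A²`, the conditional variance of `W` is at most `2R²W + 4R²v`. The variance is
thus controlled by `W` itself. -/
theorem permTraceMGFDeriv_centredSquare_le (hn : 1 ≤ n) (hA : ∀ j k, (A j k).IsHermitian) {R : ℝ}
    (hR : ∀ j k, ‖A j k‖ ≤ R) {θ : ℝ} (hθ : 0 ≤ θ) :
    permTraceMGFDeriv (isHermitian_centredSquare hA) θ ≤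
      θ * (2 * R ^ 2 * permTraceMGFDeriv (isHermitian_centredSquare hA) θ +
        4 * R ^ 2 * variance2 A * permTraceMGF (isHermitian_centredSquare hA) θ) := by
  have hB := isHermitian_centredSquare hA
  refine (sum_reTrace_combinatorialSum_mul_exp_le (B := fun j k => A j k ^ 2) hn hB
    (fun j k => (hA j k).pow 2) (sum_centredSquare hn A)
    (C := -((1 / (n : ℝ) ^ 2) • ∑ j, ∑ k, A j k ^ 2)) (fun j k => sub_eq_add_neg _ _) hθ).trans ?_
  refine mul_le_mul_of_nonneg_left ?_ hθ
  rw [← sum_reTrace_hermFun_exp, permTraceMGFDeriv, Finset.mul_sum, Finset.mul_sum,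
    ← Finset.sum_add_distrib]
  refine Finset.sum_le_sum fun τ _ => ?_
  rw [← reTrace_smul, ← reTrace_smul, ← reTrace_add, ← smul_mul_assoc]
  nth_rewrite 3 [← one_mul (hermFun _ _)]
  rw [← smul_mul_assoc, ← add_mul]
  refine reTrace_mul_hermFun_mono _ (fun x => (Real.exp_pos _).le) ?_
  have h1 : (∑ j, (R ^ 2 • A j (τ j) ^ 2 - (A j (τ j) ^ 2) ^ 2)).PosSemidef :=
    Matrix.posSemidef_sum _ fun j _ => posSemidef_smul_sq_sub_pow_four (hA _ _) (hR _ _)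
  have h2 : (∑ j, ∑ k, (R ^ 2 • A j k ^ 2 - (A j k ^ 2) ^ 2)).PosSemidef :=
    Matrix.posSemidef_sum _ fun j _ => Matrix.posSemidef_sum _ fun k _ =>
      posSemidef_smul_sq_sub_pow_four (hA _ _) (hR _ _)
  have h3 := ((h1.smul (zero_le_two (α := ℝ))).add 
    (h2.smul (show (0 : ℝ) ≤ 2 / n by positivity))).add
    ((posSemidef_variance2_smul_one_sub hA).smul (show 0 ≤ 4 * R ^ 2 by positivity))
  convert h3 using 1
  rw [combinatorialSum_centredSquare hn]
  simp only [Finset.sum_sub_distrib, ← Finset.smul_sum]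
  module

/-- For `4R²θ ≤ 1` the term `2R²θ m'` is at most `m'/2` when `m' > 0`, and can be absorbed on the
left. -/
theorem permTraceMGF_centredSquare_le (hn : 1 ≤ n) (hA : ∀ j k, (A j k).IsHermitian) {R : ℝ}
    (hR : ∀ j k, ‖A j k‖ ≤ R) {θ : ℝ} (hθ : 0 ≤ θ) (hθR : 4 * R ^ 2 * θ ≤ 1) :
    permTraceMGF (isHermitian_centredSquare hA) θ ≤
      n ! * d * Real.exp (4 * R ^ 2 * variance2 A * θ ^ 2) := by
  have hB := isHermitian_centredSquare hA
  have h := le_mul_exp_of_deriv_le (hasDerivAt_permTraceMGF hB) (K := 8 * R ^ 2 * variance2 A) hθ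
    fun s hs hsθ => by
      have h1 := permTraceMGFDeriv_centredSquare_le hn hA hR hs
      have h2 : 4 * R ^ 2 * s ≤ 1 :=
        (mul_le_mul_of_nonneg_left hsθ (by positivity)).trans hθR
      have h3 : 0 ≤ 8 * R ^ 2 * variance2 A * s * permTraceMGF hB s :=
        mul_nonneg (mul_nonneg (mul_nonneg (by positivity) (variance2_nonneg A)) hs)
          (permTraceMGF_nonneg hB s)
      rcases le_or_gt (permTraceMGFDeriv hB s) 0 with h4 | h4
      · exact h4.trans h3
      · have h5 := mul_le_mul_of_nonneg_right h2 h4.le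
        linarith
  rw [permTraceMGF_zero] at h
  refine h.trans (le_of_eq ?_)
  ring_nf

/-- The conditional variance is at most `2W + 4v`. Klein's inequality trades `tr(W exp(θX))` for `θ
tr(X exp(θX))` and the trace moment generating function of `W`. -/
theorem permTraceMGFDeriv_le (hn : 1 ≤ n) (hA : ∀ j k, (A j k).IsHermitian)
    (hsum : ∑ j, ∑ k, A j k = 0) {R : ℝ} (hR0 : 0 < R) (hR : ∀ j k, ‖A j k‖ ≤ R) {θ : ℝ}
    (hθ : 0 ≤ θ) :
    permTraceMGFDeriv hA θ ≤
      θ * (8 * R ^ 2 * θ * permTraceMGFDeriv hA θ + 6 * variance2 A * permTraceMGF hA θ) := by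
  have hB := isHermitian_centredSquare hA
  set v := variance2 A with hv
  -- Then `2ψ = 1/(4R²)` is the endpoint of the range allowed for `W`, where the exponent
  -- `4R²v(2ψ)²` equals `2ψv` and cancels the shift `-2ψv` in Klein's inequality.
  set ψ : ℝ := 1 / (8 * R ^ 2) with hψ
  have hψ0 : 0 < ψ := by positivity
  have hψR : 8 * R ^ 2 * ψ = 1 := by rw [hψ]; field_simp
  refine (sum_reTrace_combinatorialSum_mul_exp_le hn hA hA hsum (C := 0) (by simp) hθ).trans ?_
  refine mul_le_mul_of_nonneg_left ?_ hθ
  set E : Equiv.Perm (Fin n) → Matrix (Fin d) (Fin d) ℂ := fun τ =>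
    hermFun (isHermitian_combinatorialSum hA τ) (fun x => Real.exp (θ * x)) with hE
  set w := ∑ τ, reTrace (combinatorialSum (centredSquare A) τ * E τ) with hw
  have h1 : ∑ τ, reTrace (((2 : ℝ) • ∑ j, A j (τ j) ^ 2 + (2 / (n : ℝ)) • ∑ j, ∑ k, A j k ^ 2) *
      E τ) ≤ 2 * w + 4 * v * permTraceMGF hA θ := by
    rw [← sum_reTrace_hermFun_exp, hw, Finset.mul_sum, Finset.mul_sum, ← Finset.sum_add_distrib]
    refine Finset.sum_le_sum fun τ _ => ?_
    rw [← reTrace_smul, ← reTrace_smul, ← reTrace_add, ← smul_mul_assoc,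
      ← one_mul (hermFun _ fun x => Real.exp (θ * x)), ← smul_mul_assoc, ← add_mul]
    refine reTrace_mul_hermFun_mono _ (fun x => (Real.exp_pos _).le) ?_
    have h := (posSemidef_variance2_smul_one_sub hA).smul (zero_le_four (α := ℝ))
    convert h using 1
    rw [combinatorialSum_centredSquare hn]
    module
  have h2 : 2 * ψ * w - θ * permTraceMGFDeriv hA θ + (-(2 * ψ * v) + 1) * permTraceMGF hA θ ≤
      permTraceMGF hA θ := by
    have h3 : 2 * ψ * w - θ * permTraceMGFDeriv hA θ + (-(2 * ψ * v) + 1) * permTraceMGF hA θ ≤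
        Real.exp (-(2 * ψ * v)) * permTraceMGF hB (2 * ψ) := by
      simp only [hw, permTraceMGFDeriv, permTraceMGF,
        Finset.mul_sum (s := Finset.univ (α := Equiv.Perm (Fin n))),
        ← Finset.sum_sub_distrib, ← Finset.sum_add_distrib]
      refine Finset.sum_le_sum fun τ _ => ?_
      refine (klein_trace_exp (isHermitian_combinatorialSum hA τ)
        (isHermitian_combinatorialSum hB τ) θ (2 * ψ) (-(2 * ψ * v))).trans (le_of_eq ?_)
      rw [Finset.mul_sum]
      refine Finset.sum_congr rfl fun i _ => ?_
      rw [← Real.exp_add, add_comm]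
    have h4 := permTraceMGF_centredSquare_le hn hA hR (θ := 2 * ψ) (by positivity) (by linarith)
    have h5 : 4 * R ^ 2 * v * (2 * ψ) ^ 2 = 2 * ψ * v := by
      linear_combination (2 * ψ * v) * hψR
    rw [h5] at h4
    refine h3.trans ((mul_le_mul_of_nonneg_left h4 (Real.exp_pos _).le).trans ?_)
    rw [mul_left_comm, ← Real.exp_add, neg_add_cancel, Real.exp_zero, mul_one]
    exact permTraceMGF_ge hn hA hsum θ
  have h6 := mul_le_mul_of_nonneg_left h2 (show 0 ≤ 8 * R ^ 2 by positivity)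
  have h7 : 8 * R ^ 2 * (2 * ψ * w - θ * permTraceMGFDeriv hA θ +
      (-(2 * ψ * v) + 1) * permTraceMGF hA θ) = 2 * w - 8 * R ^ 2 * θ * permTraceMGFDeriv hA θ
        - 2 * v * permTraceMGF hA θ + 8 * R ^ 2 * permTraceMGF hA θ := by
    linear_combination (2 * w - 2 * v * permTraceMGF hA θ) * hψR
  linarith

/-- The trace moment generating function of a combinatorial sum is of Bernstein type. -/
theorem permTraceMGF_le (hn : 1 ≤ n) (hA : ∀ j k, (A j k).IsHermitian)
    (hsum : ∑ j, ∑ k, A j k = 0) {R : ℝ} (hR0 : 0 < R) (hR : ∀ j k, ‖A j k‖ ≤ R) {θ : ℝ}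
    (hθ : 0 ≤ θ) (hθR : 2 * √2 * R * θ < 1) :
    permTraceMGF hA θ ≤
      n ! * d * Real.exp (3 * variance2 A * θ ^ 2 / (1 - 2 * √2 * R * θ)) := by
  have hv := variance2_nonneg A
  have h2 : √2 * √2 = (2 : ℝ) := Real.mul_self_sqrt zero_le_two
  have hκ : 8 * R ^ 2 * θ ^ 2 = (2 * √2 * R * θ) ^ 2 := by
    linear_combination (-4 * R ^ 2 * θ ^ 2) * h2
  have hκ0 : 0 ≤ 2 * √2 * R * θ := by positivity
  have hc : 1 - 2 * √2 * R * θ ≤ 1 - 8 * R ^ 2 * θ ^ 2 := by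
    rw [hκ]; nlinarith
  have hc0 : 0 < 1 - 2 * √2 * R * θ := by linarith
  set c := 1 - 2 * √2 * R * θ with hcdef
  -- The denominator is frozen at its value `c` for the endpoint `θ`; for `s ≤ θ` it only improves.
  have h := le_mul_exp_of_deriv_le (hasDerivAt_permTraceMGF hA) (K := 6 * variance2 A / c) hθ
    fun s hs hsθ => by
      have h1 := permTraceMGFDeriv_le hn hA hsum hR0 hR hs
      have h3 : 0 ≤ 6 * variance2 A * s * permTraceMGF hA s :=
        mul_nonneg (by positivity) (permTraceMGF_nonneg hA s)
      have h4 : 6 * variance2 A / c * s * permTraceMGF hA s =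
          6 * variance2 A * s * permTraceMGF hA s / c := by ring
      rw [h4, le_div_iff₀ hc0]
      rcases le_or_gt (permTraceMGFDeriv hA s) 0 with h5 | h5
      · exact (mul_nonpos_of_nonpos_of_nonneg h5 hc0.le).trans h3
      · have h6 : c ≤ 1 - 8 * R ^ 2 * s ^ 2 := by
          have := mul_le_mul_of_nonneg_left (pow_le_pow_left₀ hs hsθ 2)
            (show 0 ≤ 8 * R ^ 2 by positivity)
          linarith
        have h7 := mul_le_mul_of_nonneg_left h6 h5.le
        linarith
  rw [permTraceMGF_zero] at h
  refine h.trans (le_of_eq ?_)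
  congr 2
  ring

end TraceMGF

/-! ### Probabilities and expectations as averages over permutations -/

section UniformPermutation

variable {Ω : Type*} [MeasurableSpace Ω] {μ : Measure Ω} {n : ℕ} {π : Ω → Equiv.Perm (Fin n)}

theorem IsUniformRandomPerm.measureReal_preimage_singleton (hπ : IsUniformRandomPerm μ π)
    (τ : Equiv.Perm (Fin n)) : μ.real (π ⁻¹' {τ}) = ((n ! : ℕ) : ℝ)⁻¹ := by
  rw [Measure.real, (hπ τ).2]
  simp

open scoped Classical in
theorem IsUniformRandomPerm.measureReal_eq (hπ : IsUniformRandomPerm μ π)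
    (p : Equiv.Perm (Fin n) → Prop) :
    μ.real {ω | p (π ω)} = ∑ τ with p τ, ((n ! : ℕ) : ℝ)⁻¹ := by
  have h : {ω | p (π ω)} = ⋃ τ ∈ Finset.univ.filter p, π ⁻¹' {τ} := by
    ext ω; simp
  have hfin : ∀ τ, μ (π ⁻¹' {τ}) ≠ ∞ := fun τ => by
    rw [(hπ τ).2]
    exact ENNReal.inv_ne_top.2 (by exact_mod_cast n.factorial_ne_zero)
  rw [h, measureReal_biUnion_finset (fun τ _ σ _ hne => ?_) (fun τ _ => (hπ τ).1)
    (fun τ _ => hfin τ)]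
  · simp only [hπ.measureReal_preimage_singleton]
  · exact Disjoint.preimage π (Set.disjoint_singleton.2 hne)

/-- Only the fibres of `π` are known to be measurable; a finite sum over them suffices for
integration. -/
theorem comp_eq_sum_indicator {Ω : Type*} (π : Ω → Equiv.Perm (Fin n))
    (f : Equiv.Perm (Fin n) → ℝ) :
    (fun ω => f (π ω)) = fun ω => ∑ τ, (π ⁻¹' {τ}).indicator (fun _ => f τ) ω := by
  classical
  funext ω
  simp [Set.indicator_apply]

theorem IsUniformRandomPerm.integrable_comp [IsFiniteMeasure μ] (hπ : IsUniformRandomPerm μ π)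
    (f : Equiv.Perm (Fin n) → ℝ) : Integrable (fun ω => f (π ω)) μ := by
  rw [comp_eq_sum_indicator]
  exact integrable_finsetSum _ fun τ _ => (integrable_const _).indicator (hπ τ).1

theorem IsUniformRandomPerm.integral_comp [IsFiniteMeasure μ] (hπ : IsUniformRandomPerm μ π)
    (f : Equiv.Perm (Fin n) → ℝ) : ∫ ω, f (π ω) ∂μ = ((n ! : ℕ) : ℝ)⁻¹ * ∑ τ, f τ := by
  rw [comp_eq_sum_indicator,
    integral_finsetSum _ fun τ _ => (integrable_const _).indicator (hπ τ).1, Finset.mul_sum]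
  refine Finset.sum_congr rfl fun τ _ => ?_
  rw [integral_indicator_const _ (hπ τ).1, hπ.measureReal_preimage_singleton, smul_eq_mul]

end UniformPermutation

/-! ### The Laplace transform method for the largest eigenvalue -/

section LambdaMax

variable {n d : ℕ} {A : Fin n → Fin n → Matrix (Fin d) (Fin d) ℂ}

theorem exp_lambdaMax_le (hd : 1 ≤ d) {M : Matrix (Fin d) (Fin d) ℂ} (hM : M.IsHermitian) (θ : ℝ) :
    Real.exp (θ * lambdaMax M) ≤ ∑ i, Real.exp (θ * hM.eigenvalues i) := by
  obtain ⟨i, hi⟩ := (isGreatest_lambdaMax hd hM).1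
  rw [← hi]
  exact Finset.single_le_sum (f := fun i => Real.exp (θ * hM.eigenvalues i))
    (fun i _ => (Real.exp_pos _).le) (Finset.mem_univ i)

theorem lambdaMax_zero (hd : 1 ≤ d) : lambdaMax (0 : Matrix (Fin d) (Fin d) ℂ) = 0 := by
  have : Nonempty (Fin d) := ⟨⟨0, hd⟩⟩
  rw [lambdaMax, spectrum.zero_eq, csSup_singleton]

theorem sum_exp_lambdaMax_le (hd : 1 ≤ d) (hA : ∀ j k, (A j k).IsHermitian) (θ : ℝ) :
    ∑ τ, Real.exp (θ * lambdaMax (combinatorialSum A τ)) ≤ permTraceMGF hA θ :=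
  Finset.sum_le_sum fun τ _ => exp_lambdaMax_le hd (isHermitian_combinatorialSum hA τ) θ

-- A sum of positive semidefinite squares vanishes only if each square does. This settles the
-- degenerate case of the theorem.
open scoped MatrixOrder ComplexOrder in
theorem eq_zero_of_variance2_eq_zero (hn : 1 ≤ n) (hA : ∀ j k, (A j k).IsHermitian)
    (hv : variance2 A = 0) (j k : Fin n) : A j k = 0 := by
  have hn0 : (n : ℝ) ≠ 0 := by exact_mod_cast (Nat.pos_of_ne_zero (by omega)).ne'
  have h0 : ∀ j k, 0 ≤ A j k ^ 2 := fun j k =>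
    Matrix.nonneg_iff_posSemidef.2 (posSemidef_sq (hA j k))
  have h1 : ∑ j, ∑ k, A j k ^ 2 = 0 := by
    rw [variance2] at hv
    exact norm_eq_zero.1 ((mul_eq_zero.1 hv).resolve_left (one_div_ne_zero hn0))
  have h2 := (Finset.sum_eq_zero_iff_of_nonneg fun j _ =>
    Finset.sum_nonneg fun k _ => h0 j k).1 h1 j (Finset.mem_univ j)
  have h3 := (Finset.sum_eq_zero_iff_of_nonneg fun k _ => h0 j k).1 h2 k (Finset.mem_univ k)
  rw [← Matrix.conjTranspose_mul_self_eq_zero, (hA j k).eq, ← pow_two, h3]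

/-- The Laplace transform bound for the tail of the largest eigenvalue. -/
theorem tail_lambdaMax_le {Ω : Type*} [MeasurableSpace Ω] {μ : Measure Ω}
    {π : Ω → Equiv.Perm (Fin n)} (hπ : IsUniformRandomPerm μ π) (hd : 1 ≤ d)
    (hA : ∀ j k, (A j k).IsHermitian) {θ q : ℝ}
    (hθ : 0 ≤ θ) (hq : permTraceMGF hA θ ≤ n ! * d * Real.exp q) (t : ℝ) :
    μ.real {ω | t ≤ lambdaMax (combinatorialSum A (π ω))} ≤ d * Real.exp (q - θ * t) := by
  classical
  have hn0 : (0 : ℝ) < (n ! : ℕ) := by exact_mod_cast n.factorial_pos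
  rw [hπ.measureReal_eq fun τ => t ≤ lambdaMax (combinatorialSum A τ)]
  have h1 : ∑ τ with t ≤ lambdaMax (combinatorialSum A τ), Real.exp (θ * t) ≤
      n ! * d * Real.exp q := by
    refine le_trans ?_ ((sum_exp_lambdaMax_le hd hA θ).trans hq)
    refine (Finset.sum_le_sum fun τ hτ => ?_).trans (Finset.sum_le_sum_of_subset_of_nonneg
      (Finset.filter_subset _ _) fun τ _ _ => (Real.exp_pos _).le)
    exact Real.exp_le_exp.2 (mul_le_mul_of_nonneg_left (Finset.mem_filter.1 hτ).2 hθ)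
  rw [Finset.sum_const, nsmul_eq_mul] at h1 ⊢
  rw [← div_eq_mul_inv, div_le_iff₀ hn0, Real.exp_sub, ← mul_div_assoc, div_mul_eq_mul_div,
    le_div_iff₀ (Real.exp_pos _)]
  linarith

/-- The Laplace transform bound for the mean of the largest eigenvalue. -/
theorem mul_integral_lambdaMax_le {Ω : Type*} [MeasurableSpace Ω] {μ : Measure Ω}
    [IsFiniteMeasure μ] {π : Ω → Equiv.Perm (Fin n)}
    (hπ : IsUniformRandomPerm μ π) (hd : 1 ≤ d)
    (hA : ∀ j k, (A j k).IsHermitian) {θ q : ℝ}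
    (hq : permTraceMGF hA θ ≤ n ! * d * Real.exp q) :
    θ * ∫ ω, lambdaMax (combinatorialSum A (π ω)) ∂μ ≤ Real.log d + q := by
  have hn0 : (0 : ℝ) < (n ! : ℕ) := by exact_mod_cast n.factorial_pos
  have hd0 : (0 : ℝ) < d := by exact_mod_cast hd
  rw [hπ.integral_comp fun τ => lambdaMax (combinatorialSum A τ)]
  set L := Real.log d + q with hL
  have h1 : ∑ τ, Real.exp (θ * lambdaMax (combinatorialSum A τ)) ≤ n ! * Real.exp L := by
    refine ((sum_exp_lambdaMax_le hd hA θ).trans hq).trans (le_of_eq ?_)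
    rw [hL, Real.exp_add, Real.exp_log hd0, mul_assoc]
  -- Jensen's inequality in tangent form, with the tangent to `exp` taken at the bound `L`.
  have h2 : ∑ τ, (θ * lambdaMax (combinatorialSum A τ) - L + 1) * Real.exp L ≤
      n ! * Real.exp L := by
    refine (Finset.sum_le_sum fun τ _ => ?_).trans h1
    have := mul_le_mul_of_nonneg_right
      (Real.add_one_le_exp (θ * lambdaMax (combinatorialSum A τ) - L)) (Real.exp_pos L).le
    rwa [← Real.exp_add, sub_add_cancel] at this
  rw [← Finset.sum_mul] at h2
  have h3 := le_of_mul_le_mul_right h2 (Real.exp_pos L)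
  simp only [Finset.sum_add_distrib, Finset.sum_sub_distrib, ← Finset.mul_sum, Finset.sum_const,
    Finset.card_univ, Fintype.card_perm, Fintype.card_fin, nsmul_eq_mul, mul_one] at h3
  rw [mul_left_comm, inv_mul_le_iff₀ hn0]
  linarith

theorem le_sqrt_mul_sqrt_add_of_forall {x v l c : ℝ} (hv : 0 < v) (hl : 0 ≤ l)
    (h : ∀ s, 0 < s → x ≤ l / s + c + 3 * v * s) : x ≤ √v * √(12 * l) + c := by
  rcases hl.eq_or_lt with rfl | hl
  · refine le_of_forall_pos_le_add fun ε hε => ?_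
    -- When `l = 0` the infimum is only approached as `s → 0`.
    have h1 := h (ε / (3 * v)) (by positivity)
    rw [mul_div_cancel₀ _ (by positivity)] at h1
    simpa using h1
  · have ha : 0 < √v := Real.sqrt_pos.2 hv
    have hb : 0 < √(12 * l) := Real.sqrt_pos.2 (by positivity)
    have ha2 : √v * √v = v := Real.mul_self_sqrt hv.le
    have hb2 : √(12 * l) * √(12 * l) = 12 * l := Real.mul_self_sqrt (by positivity)
    -- This `s = √(l/(3v))` balances `l/s` against `3vs`.
    have h1 := h (√(12 * l) / (6 * √v)) (by positivity)
    have h2 : l / (√(12 * l) / (6 * √v)) = √v * √(12 * l) / 2 := by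
      rw [div_div_eq_mul_div, div_eq_iff hb.ne']
      linear_combination (-√v / 2) * hb2
    have h3 : 3 * v * (√(12 * l) / (6 * √v)) = √v * √(12 * l) / 2 := by
      rw [← mul_div_assoc, div_eq_iff (by positivity)]
      linear_combination (-3 * √(12 * l)) * ha2
    rw [h2, h3] at h1
    linarith

end LambdaMax

theorem mainTheorem8 {Ω : Type*} [MeasurableSpace Ω] (μ : Measure Ω) [IsProbabilityMeasure μ]
    {n d : ℕ} (hn : 1 ≤ n) (hd : 1 ≤ d)
    (A : Fin n → Fin n → Matrix (Fin d) (Fin d) ℂ)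
    (hA : ∀ j k, (A j k).IsHermitian)
    (hsum : ∑ j, ∑ k, A j k = 0)
    (R : ℝ) (hR : ∀ j k, ‖A j k‖ ≤ R)
    (π : Ω → Equiv.Perm (Fin n)) (hπ : IsUniformRandomPerm μ π) :
    (∀ t : ℝ, 0 ≤ t →
      μ.real {ω | t ≤ lambdaMax (combinatorialSum A (π ω))} ≤
        d * Real.exp (-t ^ 2 / (12 * variance2 A + 4 * √2 * R * t))) ∧
    Integrable (fun ω => lambdaMax (combinatorialSum A (π ω))) μ ∧
    ∫ ω, lambdaMax (combinatorialSum A (π ω)) ∂μ ≤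
      √(variance2 A) * √(12 * Real.log d) + 2 * √2 * R * Real.log d := by
  have hd1 : (1 : ℝ) ≤ d := by exact_mod_cast hd
  have hlog : 0 ≤ Real.log d := Real.log_nonneg hd1
  have hR0 : 0 ≤ R := (norm_nonneg _).trans (hR ⟨0, hn⟩ ⟨0, hn⟩)
  -- The bound on `permTraceMGF` needs `R > 0`; `R = 0` falls under zero variance.
  have hRne : 0 < variance2 A → R ≠ 0 := by
    rintro hv rfl
    have hA0 : ∀ j k, A j k = 0 := fun j k => norm_le_zero_iff.1 (hR j k)
    simp [variance2, hA0] at hv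
  have htail_zero : μ.real {ω | 0 ≤ lambdaMax (combinatorialSum A (π ω))} ≤
      d * Real.exp (-0 ^ 2 / (12 * variance2 A + 4 * √2 * R * 0)) := by
    simpa using measureReal_le_one.trans hd1
  refine ⟨?_, hπ.integrable_comp fun τ => lambdaMax (combinatorialSum A τ), ?_⟩ <;>
    rcases (variance2_nonneg A).eq_or_lt with hv | hv
  · intro t ht
    rcases ht.eq_or_lt with rfl | ht
    · exact htail_zero
    · have hA0 := eq_zero_of_variance2_eq_zero hn hA hv.symm
      simp only [combinatorialSum, hA0, Finset.sum_const_zero, lambdaMax_zero hd, ht.not_ge,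
        Set.ofPred_false, measureReal_empty]
      positivity
  · intro t ht
    rcases ht.eq_or_lt with rfl | ht
    · exact htail_zero
    · have hRpos := hR0.lt_of_ne' (hRne hv)
      set κ := 2 * √2 * R with hκ
      have hκ0 : 0 < κ := by positivity
      have hD : 0 < 6 * variance2 A + κ * t := by positivity
      have hκθ : 1 - κ * (t / (6 * variance2 A + κ * t)) =
          6 * variance2 A / (6 * variance2 A + κ * t) := by
        field_simp
        ring
      have hpos : 0 < 1 - κ * (t / (6 * variance2 A + κ * t)) := by rw [hκθ]; positivity
      -- With `θ = t/(6v + κt)` the exponent `3vθ²/(1 - κθ)` is exactly `θt/2`.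
      refine (tail_lambdaMax_le hπ hd hA (by positivity) (permTraceMGF_le hn hA hsum hRpos hR
        (θ := t / (6 * variance2 A + κ * t)) (by positivity) (by linarith)) t).trans (le_of_eq ?_)
      rw [← hκ, hκθ, show 12 * variance2 A + 4 * √2 * R * t = 2 * (6 * variance2 A + κ * t) by
        rw [hκ]; ring]
      congr 2
      field_simp
      ring
  · have hA0 := eq_zero_of_variance2_eq_zero hn hA hv.symm
    simp only [combinatorialSum, hA0, Finset.sum_const_zero, lambdaMax_zero hd, integral_zero]
    positivity
  · have hRpos := hR0.lt_of_ne' (hRne hv)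
    refine le_sqrt_mul_sqrt_add_of_forall hv hlog fun s hs => ?_
    set κ := 2 * √2 * R with hκ
    have hκ0 : 0 < κ := by positivity
    have hD : 0 < 1 + κ * s := by positivity
    have hκθ : 1 - κ * (s / (1 + κ * s)) = 1 / (1 + κ * s) := by
      field_simp
      ring
    have hpos : 0 < 1 - κ * (s / (1 + κ * s)) := by rw [hκθ]; positivity
    -- Substituting `θ = s/(1 + κs)` turns the bound into `log d / s + κ log d + 3vs`, with `s > 0`
    -- free.
    have h := mul_integral_lambdaMax_le hπ hd hA (permTraceMGF_le hn hA hsum hRpos hR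
      (θ := s / (1 + κ * s)) (by positivity) (by linarith))
    rw [← hκ, hκθ, div_mul_eq_mul_div, div_le_iff₀ hD] at h
    refine le_of_mul_le_mul_left (h.trans (le_of_eq ?_)) hs
    field_simp
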